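/- Let $q = 2^n$ with $q > 2$, let $V$ be a $4$-dimensional vector space over the finite field $\mathbb{F}_q$ with a non-degenerate alternating bilinear form $B$, and let $P$ be the set of points of the projective space $PG(3,q)$ of $V$. The symplectic generalized quadrangle $W(q)$ has the points in $P$ as its points, and as its lines those lines of $PG(3,q)$ (two-dimensional subspaces of $V$) that are totally isotropic for $B$. A dual grid of $W(q)$ is a set of points $m\cup m^{\perp}\subseteq P$, where $m$ is a line of $PG(3,q)$ that is not a line of $W(q)$ and $m^{\perp}$ is its orthogonal with respect to $B$. Identify a subset of $P$ with its characteristic function in $\mathbb{F}_2^P$. Let $\mathcal{C}$ and $\mathcal{D}$ be the subspaces of $\mathbb{F}_2^P$ spanned by the lines of $W(q)$ and by the dual grids of $W(q)$, respectively, and let $\mathcal{C}^{\perp}$ be the dual code of $\mathcal{C}$ with respect to the standard dot product on $\mathbb{F}_2^P$. Then $\mathcal{D}$ is a proper subspace of $\mathcal{C}^{\perp}$, that is, $\mathcal{D}\subsetneq\mathcal{C}^{\perp}$. -/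

import Mathlib

open scoped LinearAlgebra.Projectivization

noncomputable section

namespace SymplecticQuadrangle

/-- The word in `𝔽₂^ι` identified with a subset of `ι`: its characteristic function. -/
def charWord {ι : Type*} (S : Set ι) : ι → ZMod 2 := S.indicator 1

/-- The dual code of a binary code: all words orthogonal to every codeword with respect to
the standard dot product. -/
def dualCode {ι : Type*} [Fintype ι] (C : Submodule (ZMod 2) (ι → ZMod 2)) :
    Submodule (ZMod 2) (ι → ZMod 2) where
  carrier := {w | ∀ c ∈ C, w ⬝ᵥ c = 0}
  zero_mem' := fun c _ => zero_dotProduct c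
  add_mem' := fun {a b} ha hb c hc => by rw [add_dotProduct, ha c hc, hb c hc, add_zero]
  smul_mem' := fun r w hw c hc => by rw [smul_dotProduct, hw c hc, smul_zero]

variable {F V : Type*} [Field F] [AddCommGroup V] [Module F V]

/-- The points of the projective space of `V` that lie on a subspace of `V`. -/
def pointSet (m : Submodule F V) : Set (ℙ F V) := {p | p.submodule ≤ m}

/-- The (projective) lines of the incidence system `W` of the form `B`: the two-dimensional
subspaces that are totally isotropic. -/
def IsIsotropicLine (B : LinearMap.BilinForm F V) (m : Submodule F V) : Prop :=
  Module.finrank F m = 2 ∧ ∀ x ∈ m, ∀ y ∈ m, B x y = 0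

/-- The dual grids: the point sets `m ∪ m^⊥`, where `m` is a projective line that is not a line
of `W`. -/
def IsDualGrid (B : LinearMap.BilinForm F V) (S : Set (ℙ F V)) : Prop :=
  ∃ m : Submodule F V, Module.finrank F m = 2 ∧ ¬ IsIsotropicLine B m ∧
    S = pointSet m ∪ pointSet (B.orthogonal m)

/-- The binary code spanned by the lines of `W`. -/
def lineCode (B : LinearMap.BilinForm F V) : Submodule (ZMod 2) (ℙ F V → ZMod 2) :=
  Submodule.span (ZMod 2) {w | ∃ m, IsIsotropicLine B m ∧ w = charWord (pointSet m)}

/-- The binary code spanned by the dual grids of `W`. -/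
def dualGridCode (B : LinearMap.BilinForm F V) : Submodule (ZMod 2) (ℙ F V → ZMod 2) :=
  Submodule.span (ZMod 2) {w | ∃ S, IsDualGrid B S ∧ w = charWord S}

end SymplecticQuadrangle

end

/-!
Isotropic lines are equal to their orthogonals, so by a dimension count such a line meets `m` and
`m^⊥` in equally many points; hence dual grids lie in the dual code of the lines
(`dualGridCode_le`).

The inclusion is strict because of a pair of `F`-valued words. Choose symplectic coordinates
`x₁, x₂, x₃, x₄` and consider the quadratic forms `R = x₁x₂` and `Q = x₁x₂ + x₃x₄`, where `Q` has
polar form `B`. Let `t = R / Q`, with value zero where `Q` vanishes; it is a function on the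
projective points.

* `t⁻¹ = Q / R` has sum zero over each isotropic line, because `Q` is additive there
  (`IsSymplecticFrame.sum_inv_ratio`).
* `t + t²` has sum zero over each dual grid. For a plane `m` with a hyperbolic pair `x, y`, the sum
  of `t` over the points of `m` is the value of the polar form of `R` at `(x, y)`
  (`IsSymplecticFrame.sum_ratio`). Expanding `B(e₁, e₂) = 1`, for the first two vectors of the
  symplectic basis, in a frame adapted to `m` and `m^⊥` shows that the sums `s` and `s'` of `t`
  over `m` and `m^⊥` add up to one, and so `(s + s²) + (s' + s'²) = 0`
  (`IsSymplecticFrame.sum_ratio_add_sq`).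
* The dot product of `t⁻¹` and `t + t²` is one (`IsSymplecticFrame.sum_inv_ratio_mul`).

The coordinates of `t⁻¹` with respect to a basis of `F` over `𝔽₂` are binary words of the dual code.
If all of them were sums of dual grids, the dot product would vanish
(`sum_mul_eq_zero_of_coord_mem`).

All sums over lines reduce to the fact that `∑ b, (A + β b + C b²)⁻¹ = 0` when `q > 2`
(`sum_inv_quadratic_eq_zero`). The convention `0⁻¹ = 0` is what makes this identity, and the words
above, insensitive to the zeros of the denominators. The case `q = 2` fails since the sum of all
inverses in the field is then one. Sums over projective points are replaced by sums over vectors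
throughout, each point carrying the odd number `q - 1` of nonzero vectors (`sum_rep_eq_sum`).
-/

namespace SymplecticQuadrangle

/-! ### Sums over a finite field of characteristic two -/

section FieldSums

variable {F : Type*} [Field F] [Fintype F] [CharP F 2]

lemma card_cast_eq_zero {A : Type*} [Ring A] [CharP A 2] : (Fintype.card F : A) = 0 := by
  obtain ⟨n, -, h⟩ := FiniteField.card F 2
  rw [h, Nat.cast_pow, Nat.cast_two, CharTwo.two_eq_zero, zero_pow n.ne_zero]

lemma card_units_cast_eq_one {A : Type*} [Ring A] [CharP A 2] [Fintype Fˣ] :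
    (Fintype.card Fˣ : A) = 1 := by
  classical
  have h : ((Fintype.card F : ℕ) : A) = 0 := card_cast_eq_zero
  rw [Fintype.card_eq_card_units_add_one, Nat.cast_add, Nat.cast_one] at h
  rw [← CharTwo.neg_eq (1 : A), ← eq_neg_of_add_eq_zero_left h]
  congr!

/-- A constant summed over the nonzero elements is unchanged, as `q - 1` is odd. -/
lemma sum_eq_of_const_off_zero (g : F → F) (K : F) (h : ∀ a, a ≠ 0 → g a = K) :
    ∑ a, g a = g 0 + K := by
  classical
  have h' : ∀ a, g a = K + if a = 0 then g 0 + K else 0 := by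
    intro a
    split_ifs with ha
    · rw [ha, add_comm (g 0), ← add_assoc, CharTwo.add_self_eq_zero, zero_add]
    · rw [h a ha, add_zero]
  rw [Finset.sum_congr rfl fun a _ => h' a, Finset.sum_add_distrib, Finset.sum_const,
    Finset.card_univ, nsmul_eq_mul, card_cast_eq_zero]
  simp

lemma sum_inv_eq_zero {K : Type*} [Field K] [Fintype K] (hq : 2 < Fintype.card K) :
    ∑ x : K, x⁻¹ = 0 := by
  have h := FiniteField.sum_pow_lt_card_sub_one K 1 (by omega)
  rw [← h]
  exact Fintype.sum_equiv (Equiv.inv K) _ _ fun x => by simp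

lemma sum_inv_comp_eq_zero {K : Type*} [Field K] [Fintype K] (hq : 2 < Fintype.card K)
    (g : K → K) (hg : Function.Injective g) : ∑ x, (g x)⁻¹ = 0 := by
  rw [← sum_inv_eq_zero hq]
  exact Fintype.sum_bijective g (Finite.injective_iff_bijective.mp hg) _ _ fun _ => rfl

/-- Every function of `A + β b + C b²` with `β, C ≠ 0` has sum zero over `b`, because
`b ↦ b + β / C` pairs off the elements of the field. -/
lemma sum_comp_quadratic_eq_zero (φ : F → F) {A β C : F} (hβ : β ≠ 0) (hC : C ≠ 0) :
    ∑ b, φ (A + β * b + C * b ^ 2) = 0 := by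
  have h2 : (2 : F) = 0 := CharTwo.two_eq_zero
  refine Finset.sum_involution (fun b _ => b + β / C) ?_ ?_ ?_ ?_
  · intro b _
    have : A + β * (b + β / C) + C * (b + β / C) ^ 2 = A + β * b + C * b ^ 2 := by
      field_simp
      linear_combination (β * C * b + β ^ 2) * h2
    rw [this, CharTwo.add_self_eq_zero]
  · intro b _ _ hb
    exact div_ne_zero hβ hC (by simpa using hb)
  · intro b _; exact Finset.mem_univ _
  · intro b _
    rw [add_assoc, CharTwo.add_self_eq_zero, add_zero]

lemma sum_inv_quadratic_eq_zero (hq : 2 < Fintype.card F) (A β C : F) :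
    ∑ b, (A + β * b + C * b ^ 2)⁻¹ = 0 := by
  by_cases hβ : β = 0 <;> by_cases hC : C = 0
  · simp [hβ, hC]
  · refine sum_inv_comp_eq_zero hq _ fun a b hab => ?_
    exact CharTwo.sq_injective (by simpa [hβ, hC] using hab)
  · refine sum_inv_comp_eq_zero hq _ fun a b hab => ?_
    simpa [hβ, hC] using hab
  · exact sum_comp_quadratic_eq_zero _ hβ hC

/-- Modulo two, the number of values of the parameter for which a quadratic polynomial with a
nonzero linear coefficient does not vanish. -/
lemma sum_quadratic_div_self {A β C : F} (hβ : β ≠ 0) :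
    ∑ b, (A + β * b + C * b ^ 2) / (A + β * b + C * b ^ 2) = 1 + C / C := by
  by_cases hC : C = 0
  · have hbij : Function.Bijective fun b : F => A + β * b + C * b ^ 2 := by
      refine Finite.injective_iff_bijective.mp fun a b hab => ?_
      simpa [hβ, hC] using hab
    rw [Fintype.sum_bijective _ hbij _ (fun x : F => x / x) fun _ => rfl,
      sum_eq_of_const_off_zero _ 1 fun a ha => div_self ha]
    simp [hC]
  · rw [sum_comp_quadratic_eq_zero (fun x => x / x) hβ hC, div_self hC,
      CharTwo.add_self_eq_zero]

/-- The sum over the plane of a function that is invariant under scaling off the line `a = 0` only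
needs the two lines `a = 0` and `a = 1`, since the `q - 1` lines `a = const ≠ 0` contribute
equally. -/
lemma sum_homogeneous (h : F → F → F) (hh : ∀ a b, a ≠ 0 → h a (a * b) = h 1 b) :
    ∑ a, ∑ b, h a b = ∑ b, h 0 b + ∑ b, h 1 b := by
  refine sum_eq_of_const_off_zero (fun a => ∑ b, h a b) _ fun a ha => ?_
  rw [← Fintype.sum_equiv (Equiv.mulLeft₀ a ha) (fun b => h a (a * b)) _ fun b => rfl]
  exact Finset.sum_congr rfl fun b _ => hh a b ha

lemma sum_sq_div_binary_form (hq : 2 < Fintype.card F) (A β C : F) :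
    ∑ a, ∑ b, a ^ 2 / (A * a ^ 2 + β * (a * b) + C * b ^ 2) = 0 := by
  rw [sum_homogeneous]
  · simpa using sum_inv_quadratic_eq_zero hq A β C
  · intro a b ha
    rw [show A * a ^ 2 + β * (a * (a * b)) + C * (a * b) ^ 2
      = a ^ 2 * (A + β * b + C * b ^ 2) by ring]
    field_simp

lemma sum_sq_div_binary_form' (hq : 2 < Fintype.card F) (A β C : F) :
    ∑ a, ∑ b, b ^ 2 / (A * a ^ 2 + β * (a * b) + C * b ^ 2) = 0 := by
  rw [Finset.sum_comm, ← sum_sq_div_binary_form hq C β A]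
  refine Finset.sum_congr rfl fun a _ => Finset.sum_congr rfl fun b _ => ?_
  congr 1
  ring

lemma sum_binary_form_div_self {A β C : F} (hβ : β ≠ 0) :
    ∑ a, ∑ b, (A * a ^ 2 + β * (a * b) + C * b ^ 2) /
      (A * a ^ 2 + β * (a * b) + C * b ^ 2) = 1 := by
  rw [sum_homogeneous]
  · have h0 : ∑ b : F, (A * 0 ^ 2 + β * (0 * b) + C * b ^ 2) /
        (A * 0 ^ 2 + β * (0 * b) + C * b ^ 2) = C / C := by
      rw [sum_eq_of_const_off_zero _ (C / C)]
      · simp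
      · intro b hb
        simp only [ne_eq, OfNat.ofNat_ne_zero, not_false_eq_true, zero_pow, mul_zero, zero_mul,
          zero_add]
        rw [mul_div_mul_right _ _ (pow_ne_zero 2 hb)]
    have h1 := sum_quadratic_div_self (A := A) (C := C) hβ
    simp only [one_pow, mul_one, one_mul]
    rw [h0, h1, add_comm 1, ← add_assoc, CharTwo.add_self_eq_zero, zero_add]
  · intro a b ha
    rw [show A * a ^ 2 + β * (a * (a * b)) + C * (a * b) ^ 2
      = a ^ 2 * (A * 1 ^ 2 + β * (1 * b) + C * b ^ 2) by ring,
      mul_div_mul_left _ _ (pow_ne_zero 2 ha)]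

/-- The sum over a line of the quotient of two binary quadratic forms only sees their polar
coefficients. -/
lemma sum_binary_form_div (hq : 2 < Fintype.card F) (A' β' C' A C : F) {β : F} (hβ : β ≠ 0) :
    ∑ a, ∑ b, (A' * a ^ 2 + β' * (a * b) + C' * b ^ 2) /
      (A * a ^ 2 + β * (a * b) + C * b ^ 2) = β' / β := by
  have key : ∀ a b : F, (A' * a ^ 2 + β' * (a * b) + C' * b ^ 2) /
      (A * a ^ 2 + β * (a * b) + C * b ^ 2) =
      (β' / β) * ((A * a ^ 2 + β * (a * b) + C * b ^ 2) /
        (A * a ^ 2 + β * (a * b) + C * b ^ 2)) +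
      ((A' - β' / β * A) * (a ^ 2 / (A * a ^ 2 + β * (a * b) + C * b ^ 2)) +
      (C' - β' / β * C) * (b ^ 2 / (A * a ^ 2 + β * (a * b) + C * b ^ 2))) := by
    intro a b
    generalize hD : (A * a ^ 2 + β * (a * b) + C * b ^ 2)⁻¹ = D
    simp only [div_eq_mul_inv _ (A * a ^ 2 + β * (a * b) + C * b ^ 2), hD]
    field_simp
    ring
  simp only [key, Finset.sum_add_distrib, ← Finset.mul_sum, sum_binary_form_div_self hβ,
    sum_sq_div_binary_form hq, sum_sq_div_binary_form' hq, mul_zero, mul_one, add_zero]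

/-- The quotient of an additive quadratic form by any quadratic form sums to zero. -/
lemma sum_diagonal_form_div (hq : 2 < Fintype.card F) (A' C' A β C : F) :
    ∑ a, ∑ b, (A' * a ^ 2 + C' * b ^ 2) / (A * a ^ 2 + β * (a * b) + C * b ^ 2) = 0 := by
  simp only [add_div, mul_div_assoc A', mul_div_assoc C', Finset.sum_add_distrib,
    ← Finset.mul_sum, sum_sq_div_binary_form hq, sum_sq_div_binary_form' hq, mul_zero, add_zero]

lemma sum_div_const_add (hq : 2 < Fintype.card F) (P : F) :
    ∑ c, ∑ d, (c * d) / (P + c * d) = 1 := by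
  rw [sum_eq_of_const_off_zero (fun c => ∑ d, (c * d) / (P + c * d)) 1]
  · simp
  intro c hc
  rw [Fintype.sum_equiv ((Equiv.mulLeft₀ c hc).trans (Equiv.addLeft P)) _
    (fun z => z / z - P * z⁻¹) ?_]
  · rw [Finset.sum_sub_distrib, ← Finset.mul_sum, sum_inv_eq_zero hq,
      sum_eq_of_const_off_zero _ 1 fun a ha => div_self ha]
    simp
  · intro d
    change _ = (P + c * d) / (P + c * d) - P * (P + c * d)⁻¹
    rw [← div_eq_mul_inv, ← sub_div, add_sub_cancel_left]

end FieldSums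

/-! ### Sums over projective points -/

section PointSums

variable {F V : Type*} [Field F] [AddCommGroup V] [Module F V]

lemma mem_pointSet_iff (m : Submodule F V) (p : ℙ F V) : p ∈ pointSet m ↔ p.rep ∈ m := by
  rw [pointSet, Set.mem_ofPred_eq, p.submodule_eq, Submodule.span_singleton_le_iff_mem]

variable [Fintype F] [CharP F 2] [Fintype V] [Fintype (ℙ F V)]

/-- In characteristic two, a sum over projective points is the sum over all vectors, since each
point carries the odd number `q - 1` of nonzero vectors. -/
lemma sum_rep_eq_sum {A : Type*} [Ring A] [CharP A 2] (h : V → A) (h0 : h 0 = 0)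
    (hh : ∀ (c : F) v, c ≠ 0 → h (c • v) = h v) : ∑ p : ℙ F V, h p.rep = ∑ v, h v := by
  classical
  have h1 : ∑ v, h v = ∑ v : {v : V // v ≠ 0}, h v := by
    rw [← Finset.sum_subtype (Finset.univ.filter (· ≠ 0)) (by simp) h, Finset.sum_filter]
    refine Finset.sum_congr rfl fun v _ => ?_
    split_ifs with hv
    · rfl
    · rw [not_not.mp hv, h0]
  let e : ℙ F V × Fˣ → {v : V // v ≠ 0} := fun x =>
    ⟨(x.2 : F) • x.1.rep, smul_ne_zero x.2.ne_zero x.1.rep_nonzero⟩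
  have he : Function.Bijective e := by
    constructor
    · rintro ⟨p, c⟩ ⟨p', c'⟩ hpc
      have hv : (c : F) • p.rep = (c' : F) • p'.rep := congrArg Subtype.val hpc
      have hp : p = p' := by
        rw [← p.mk_rep, ← p'.mk_rep, Projectivization.mk_eq_mk_iff']
        refine ⟨(c : F)⁻¹ * c', ?_⟩
        rw [mul_smul, ← hv, inv_smul_smul₀ c.ne_zero]
      subst hp
      rw [Prod.mk.injEq]
      exact ⟨rfl, Units.ext (smul_left_injective F p.rep_nonzero hv)⟩
    · rintro ⟨v, hv⟩
      obtain ⟨c, hc⟩ := Projectivization.exists_smul_eq_mk_rep F v hv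
      refine ⟨(Projectivization.mk F v hv, c⁻¹), Subtype.ext ?_⟩
      change ((c⁻¹ : Fˣ) : F) • _ = v
      rw [← hc, Units.smul_def, Units.val_inv_eq_inv_val, inv_smul_smul₀ c.ne_zero]
  rw [h1, ← Fintype.sum_bijective e he (fun x => h x.1.rep) _
    fun x => (hh x.2 _ x.2.ne_zero).symm, Fintype.sum_prod_type]
  refine Finset.sum_congr rfl fun p _ => ?_
  change _ = ∑ _c : Fˣ, h p.rep
  rw [Finset.sum_const, Finset.card_univ, nsmul_eq_mul, card_units_cast_eq_one, one_mul]

end PointSums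

/-! ### Symplectic frames -/

section Frames

variable {F V : Type*} [Field F] [AddCommGroup V] [Module F V]

lemma exists_eq_span_pair {m : Submodule F V} (hm : Module.finrank F m = 2) :
    ∃ x y, LinearIndependent F ![x, y] ∧ m = Submodule.span F {x, y} := by
  have : Module.Finite F m := Module.finite_of_finrank_pos (by omega)
  let b := Module.finBasisOfFinrankEq F m hm
  have hv : (fun i => (b i : V)) = ![(b 0 : V), (b 1 : V)] := by
    ext i; fin_cases i <;> rfl
  refine ⟨b 0, b 1, ?_, ?_⟩
  · rw [← hv]
    exact b.linearIndependent.map' m.subtype m.ker_subtype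
  · have h := congrArg (Submodule.map m.subtype) b.span_eq
    rw [Submodule.map_span, Submodule.map_top, Submodule.range_subtype, ← Set.range_comp] at h
    rw [← Matrix.range_cons_cons_empty (b 0 : V) (b 1 : V) ![]]
    refine h.symm.trans ?_
    rw [← hv]
    rfl

variable {B : LinearMap.BilinForm F V}

/-- A symplectic basis `x, y, z, w` of `V` in characteristic two: `(x, y)` and `(z, w)` are
hyperbolic pairs spanning mutually orthogonal planes. The last field says that these vectors
span `V`, by giving the coordinates of a vector in terms of `B`. -/
structure IsSymplecticFrame (B : LinearMap.BilinForm F V) (x y z w : V) : Prop where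
  xy : B x y = 1
  zw : B z w = 1
  xz : B x z = 0
  xw : B x w = 0
  yz : B y z = 0
  yw : B y w = 0
  expand : ∀ v, v = (B v y • x + B v x • y) + (B v w • z + B v z • w)

/-- The bilinear form in the coordinates of a symplectic frame. -/
lemma IsSymplecticFrame.bilin_apply {x y z w : V} (h : IsSymplecticFrame B x y z w)
    (u v : V) :
    B u v = (B u x * B v y + B u y * B v x) + (B u z * B v w + B u w * B v z) := by
  conv_lhs => rw [h.expand v]
  simp only [map_add, map_smul, smul_eq_mul]
  ring

lemma bilin_comm [CharP F 2] (hAlt : B.IsAlt) (u v : V) : B u v = B v u := by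
  rw [← hAlt.neg_eq, CharTwo.neg_eq]

/-- A non-isotropic plane has a basis that is a hyperbolic pair. -/
lemma exists_hyperbolic_pair (hAlt : B.IsAlt) {m : Submodule F V}
    (hm : Module.finrank F m = 2) (hni : ¬ IsIsotropicLine B m) :
    ∃ x y, B x y = 1 ∧ m = Submodule.span F {x, y} := by
  obtain ⟨x, y, -, rfl⟩ := exists_eq_span_pair hm
  have hxy : B x y ≠ 0 := by
    intro h
    refine hni ⟨hm, fun u hu v hv => ?_⟩
    obtain ⟨a, b, rfl⟩ := Submodule.mem_span_pair.mp hu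
    obtain ⟨c, d, rfl⟩ := Submodule.mem_span_pair.mp hv
    simp [h, hAlt.self_eq_zero, ← hAlt.neg_eq x y]
  refine ⟨(B x y)⁻¹ • x, y, by simp [hxy], ?_⟩
  refine le_antisymm (Submodule.span_le.mpr ?_) (Submodule.span_le.mpr ?_)
  · rintro v (rfl | rfl)
    · exact Submodule.mem_span_pair.mpr ⟨B v y, 0, by simp [smul_smul, hxy]⟩
    · exact Submodule.subset_span (by simp)
  · rintro v (rfl | rfl)
    · exact Submodule.smul_mem _ _ (Submodule.subset_span (by simp))
    · exact Submodule.subset_span (by simp)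

variable [CharP F 2]

lemma linearIndependent_of_hyperbolic_pair (hAlt : B.IsAlt) {s t : V} (hst : B s t = 1) :
    LinearIndependent F ![s, t] := by
  rw [LinearIndependent.pair_iff]
  intro a b hab
  have h1 := congrArg (B s) hab
  have h2 := congrArg (B t) hab
  have hts : B t s = 1 := by rw [bilin_comm hAlt, hst]
  simp only [map_add, map_smul, hAlt.self_eq_zero, hst, hts, smul_eq_mul, mul_zero, mul_one,
    zero_add, add_zero, map_zero] at h1 h2
  exact ⟨h2, h1⟩

lemma sub_mem_orthogonal_span (hAlt : B.IsAlt) {x y : V} (hxy : B x y = 1) (v : V) :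
    v - (B v y • x + B v x • y) ∈ B.orthogonal (Submodule.span F {x, y}) := by
  intro u hu
  obtain ⟨a, b, rfl⟩ := Submodule.mem_span_pair.mp hu
  have hyx : B y x = 1 := by rw [bilin_comm hAlt, hxy]
  simp only [map_add, map_smul, LinearMap.add_apply, LinearMap.smul_apply, smul_eq_mul, map_sub,
    hAlt.self_eq_zero, hxy, hyx, bilin_comm hAlt v]
  ring

lemma disjoint_orthogonal (hAlt : B.IsAlt) {x y : V} (hxy : B x y = 1) :
    Disjoint (Submodule.span F {x, y}) (B.orthogonal (Submodule.span F {x, y})) := by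
  rw [Submodule.disjoint_def]
  intro v hv hv'
  obtain ⟨a, b, rfl⟩ := Submodule.mem_span_pair.mp hv
  have h1 := hv' x (Submodule.subset_span (by simp))
  have h2 := hv' y (Submodule.subset_span (by simp))
  have hyx : B y x = 1 := by rw [bilin_comm hAlt, hxy]
  simp only [map_add, map_smul, hAlt.self_eq_zero, hxy, hyx, smul_eq_mul, mul_zero, mul_one,
    zero_add, add_zero] at h1 h2
  simp [h1, h2]

/-- Every non-isotropic plane and its orthogonal are spanned by the two halves of a symplectic
frame. -/
lemma exists_symplecticFrame (hV : Module.finrank F V = 4) (hAlt : B.IsAlt)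
    (hB : B.Nondegenerate) {m : Submodule F V} (hm : Module.finrank F m = 2)
    (hni : ¬ IsIsotropicLine B m) :
    ∃ x y z w, IsSymplecticFrame B x y z w ∧ m = Submodule.span F {x, y} ∧
      B.orthogonal m = Submodule.span F {z, w} := by
  have : Module.Finite F V := Module.finite_of_finrank_pos (by omega)
  obtain ⟨x, y, hxy, rfl⟩ := exists_hyperbolic_pair hAlt hm hni
  have hm' : Module.finrank F (B.orthogonal (Submodule.span F {x, y})) = 2 := by
    rw [LinearMap.BilinForm.finrank_orthogonal hB, hV, hm]
  have hni' : ¬ IsIsotropicLine B (B.orthogonal (Submodule.span F {x, y})) := by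
    rintro ⟨-, h⟩
    have hle : B.orthogonal (Submodule.span F {x, y}) ≤ Submodule.span F {x, y} := by
      rw [← LinearMap.BilinForm.orthogonal_orthogonal hB hAlt.isRefl (Submodule.span F {x, y})]
      intro u hu v hv
      rw [LinearMap.BilinForm.orthogonal_orthogonal hB hAlt.isRefl] at hu
      exact h _ hv _ hu
    have h0 := (disjoint_orthogonal hAlt hxy).eq_bot
    rw [inf_eq_right.mpr hle] at h0
    rw [h0, finrank_bot] at hm'
    omega
  obtain ⟨z, w, hzw, hspan⟩ := exists_hyperbolic_pair hAlt hm' hni'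
  have ho : ∀ u ∈ ({x, y} : Set V), ∀ v ∈ ({z, w} : Set V), B u v = 0 := by
    intro u hu v hv
    have hv' : v ∈ B.orthogonal (Submodule.span F {x, y}) := by
      rw [hspan]; exact Submodule.subset_span hv
    exact hv' u (Submodule.subset_span hu)
  have xz := ho x (by simp) z (by simp)
  have xw := ho x (by simp) w (by simp)
  have yz := ho y (by simp) z (by simp)
  have yw := ho y (by simp) w (by simp)
  refine ⟨x, y, z, w, ⟨hxy, hzw, xz, xw, yz, yw, fun v => ?_⟩, rfl, hspan⟩
  have hv := sub_mem_orthogonal_span hAlt hxy v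
  rw [hspan] at hv
  obtain ⟨a, b, hab⟩ := Submodule.mem_span_pair.mp hv
  have hwz : B w z = 1 := by rw [bilin_comm hAlt, hzw]
  have hv2 : v = (B v y • x + B v x • y) + (a • z + b • w) := by rw [hab]; abel
  have hb : B v z = b := by
    rw [hv2]; simp [xz, yz, hAlt.self_eq_zero, hwz]
  have ha : B v w = a := by
    rw [hv2]; simp [xw, yw, hAlt.self_eq_zero, hzw]
  rw [hb, ha]
  exact hv2

lemma exists_symplecticFrame_of_nondegenerate (hV : Module.finrank F V = 4) (hAlt : B.IsAlt)
    (hB : B.Nondegenerate) : ∃ x y z w, IsSymplecticFrame B x y z w := by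
  have : Nontrivial V := Module.nontrivial_of_finrank_pos (R := F) (by omega)
  obtain ⟨u, hu⟩ := exists_ne (0 : V)
  obtain ⟨v, huv⟩ : ∃ v, B u v ≠ 0 := by
    by_contra! h
    exact hu (hB.1 u h)
  have huv' : B u ((B u v)⁻¹ • v) = 1 := by simp [huv]
  have hm := finrank_span_eq_card (linearIndependent_of_hyperbolic_pair hAlt huv')
  rw [Matrix.range_cons_cons_empty, Fintype.card_fin] at hm
  have hni : ¬ IsIsotropicLine B (Submodule.span F {u, (B u v)⁻¹ • v}) := fun h =>
    one_ne_zero (huv'.symm.trans (h.2 u (Submodule.subset_span (by simp)) _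
      (Submodule.subset_span (by simp))))
  obtain ⟨x, y, z, w, h, -⟩ := exists_symplecticFrame hV hAlt hB hm hni
  exact ⟨x, y, z, w, h⟩

end Frames

/-! ### Sums over planes -/

section PlaneSums

variable {F V A : Type*} [Field F] [AddCommGroup V] [Module F V] [Fintype F] [Fintype V]
  [AddCommMonoid A]

lemma sum_indicator_span_pair {x y : V} (hxy : LinearIndependent F ![x, y]) (h : V → A) :
    ∑ v, (Submodule.span F {x, y} : Set V).indicator h v = ∑ a : F, ∑ b : F, h (a • x + b • y) := by
  classical
  have hinj : Function.Injective fun c : F × F => c.1 • x + c.2 • y := by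
    rintro ⟨a, b⟩ ⟨a', b'⟩ hab
    obtain ⟨h1, h2⟩ := hxy.eq_of_pair hab
    exact Prod.ext h1 h2
  rw [← Fintype.sum_prod_type' (f := fun a b => h (a • x + b • y))]
  simp only [Set.indicator_apply]
  rw [← Finset.sum_filter]
  refine (Finset.sum_nbij (fun c : F × F => c.1 • x + c.2 • y) ?_ hinj.injOn ?_
    fun _ _ => rfl).symm
  · intro c _
    simpa using Submodule.mem_span_pair.mpr ⟨c.1, c.2, rfl⟩
  · intro v hv
    obtain ⟨a, b, rfl⟩ := Submodule.mem_span_pair.mp (by simpa using hv)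
    exact ⟨(a, b), by simp, rfl⟩

end PlaneSums

/-! ### Sums over point sets -/

section PointSets

variable {F V : Type*} [Field F] [AddCommGroup V] [Module F V]

lemma disjoint_pointSet {m m' : Submodule F V} (h : Disjoint m m') :
    Disjoint (pointSet m) (pointSet m') := by
  rw [Set.disjoint_left]
  intro p hp hp'
  rw [mem_pointSet_iff] at hp hp'
  exact p.rep_nonzero (Submodule.disjoint_def.mp h _ hp hp')

lemma charWord_smul {ι A : Type*} [AddCommGroup A] [Module (ZMod 2) A] (S : Set ι) (g : ι → A)
    (i : ι) : charWord S i • g i = S.indicator g i := by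
  by_cases h : i ∈ S <;> simp [charWord, h]

lemma sum_indicator_one [Fintype F] [Fintype V] {A : Type*} [Ring A]
    (m : Submodule F V) :
    ∑ v, (m : Set V).indicator (1 : V → A) v =
      (Fintype.card F : A) ^ Module.finrank F m := by
  classical
  simp only [Set.indicator_apply, SetLike.mem_coe, Pi.one_apply]
  rw [Finset.sum_boole, ← Nat.cast_pow, ← Module.card_eq_pow_finrank, Fintype.card_subtype]

variable [Fintype F] [CharP F 2] [Fintype V] [Fintype (ℙ F V)]

lemma sum_indicator_pointSet {A : Type*} [Ring A] [CharP A 2] (m : Submodule F V) (h : V → A)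
    (h0 : h 0 = 0) (hh : ∀ (c : F) v, c ≠ 0 → h (c • v) = h v) :
    ∑ p, (pointSet m).indicator (fun p => h p.rep) p = ∑ v, (m : Set V).indicator h v := by
  classical
  rw [← sum_rep_eq_sum (F := F) ((m : Set V).indicator h)]
  · refine Finset.sum_congr rfl fun p _ => ?_
    simp only [Set.indicator_apply, mem_pointSet_iff, SetLike.mem_coe]
  · simp [h0]
  · intro c v hc
    simp only [Set.indicator_apply, SetLike.mem_coe, m.smul_mem_iff hc, hh c v hc]

end PointSets

/-! ### Dual grids are orthogonal to isotropic lines -/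

section DualGrid

variable {F V : Type*} [Field F] [AddCommGroup V] [Module F V] {B : LinearMap.BilinForm F V}

lemma IsIsotropicLine.orthogonal_eq (hV : Module.finrank F V = 4) (hB : B.Nondegenerate)
    {l : Submodule F V} (hl : IsIsotropicLine B l) : B.orthogonal l = l := by
  have : Module.Finite F V := Module.finite_of_finrank_pos (by omega)
  have hle : l ≤ B.orthogonal l := fun u hu v hv => hl.2 v hv u hu
  refine (Submodule.eq_of_le_of_finrank_eq hle ?_).symm
  rw [LinearMap.BilinForm.finrank_orthogonal hB, hV, hl.1]

lemma orthogonal_sup (m l : Submodule F V) :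
    B.orthogonal (m ⊔ l) = B.orthogonal m ⊓ B.orthogonal l := by
  refine le_antisymm (le_inf (LinearMap.BilinForm.orthogonal_le le_sup_left)
    (LinearMap.BilinForm.orthogonal_le le_sup_right)) ?_
  rintro v ⟨hm, hl⟩ u hu
  obtain ⟨a, ha, b, hb, rfl⟩ := Submodule.mem_sup.mp hu
  change B (a + b) v = 0
  rw [map_add, LinearMap.add_apply, show B a v = 0 from hm a ha, show B b v = 0 from hl b hb,
    add_zero]

/-- An isotropic line meets a plane and its orthogonal in subspaces of equal dimension, since
it is its own orthogonal. -/
lemma finrank_inf_isotropicLine (hV : Module.finrank F V = 4) (hB : B.Nondegenerate)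
    {m l : Submodule F V} (hm : Module.finrank F m = 2) (hl : IsIsotropicLine B l) :
    Module.finrank F ↥(B.orthogonal m ⊓ l) = Module.finrank F ↥(m ⊓ l) := by
  have : Module.Finite F V := Module.finite_of_finrank_pos (by omega)
  have h1 := Submodule.finrank_sup_add_finrank_inf_eq m l
  have h2 := LinearMap.BilinForm.finrank_orthogonal hB (m ⊔ l)
  have h3 := Submodule.finrank_le (m ⊔ l)
  rw [orthogonal_sup, hl.orthogonal_eq hV hB] at h2
  rw [hm, hl.1] at h1
  omega

/-- A non-isotropic line has no point in common with its orthogonal. -/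
lemma disjoint_orthogonal_of_not_isotropic [CharP F 2] (hAlt : B.IsAlt) {m : Submodule F V}
    (hm : Module.finrank F m = 2) (hni : ¬ IsIsotropicLine B m) :
    Disjoint m (B.orthogonal m) := by
  obtain ⟨x, y, hxy, rfl⟩ := exists_hyperbolic_pair hAlt hm hni
  exact disjoint_orthogonal hAlt hxy

lemma dualGridCode_le [Fintype F] [CharP F 2] [Fintype (ℙ F V)] (hV : Module.finrank F V = 4)
    (hAlt : B.IsAlt) (hB : B.Nondegenerate) :
    dualGridCode B ≤ dualCode (lineCode B) := by
  classical
  have : Module.Finite F V := Module.finite_of_finrank_pos (by omega)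
  have : Finite V := Module.finite_of_finite F
  have := Fintype.ofFinite V
  refine Submodule.span_le.mpr ?_
  rintro _ ⟨_, ⟨m, hm, hni, rfl⟩, rfl⟩ c hc
  refine Submodule.span_induction ?_ (dotProduct_zero _) ?_ ?_ hc
  · rintro _ ⟨l, hl, rfl⟩
    have hd := disjoint_pointSet (disjoint_orthogonal_of_not_isotropic hAlt hm hni)
    let h : V → ZMod 2 := fun v =>
      ((m ⊓ l : Submodule F V) : Set V).indicator 1 v +
        ((B.orthogonal m ⊓ l : Submodule F V) : Set V).indicator 1 v
    have key : charWord (pointSet m ∪ pointSet (B.orthogonal m)) ⬝ᵥ charWord (pointSet l) =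
        ∑ p : ℙ F V, h p.rep := by
      refine Finset.sum_congr rfl fun p _ => ?_
      simp only [charWord, congrFun (Set.indicator_union_of_disjoint hd _) p, h,
        Set.indicator_apply, mem_pointSet_iff, SetLike.mem_coe, Submodule.mem_inf, Pi.one_apply]
      by_cases h1 : p.rep ∈ m <;> by_cases h2 : p.rep ∈ B.orthogonal m <;>
        by_cases h3 : p.rep ∈ l <;> simp [h1, h2, h3]
    rw [key, sum_rep_eq_sum (F := F) h]
    · simp only [h, Finset.sum_add_distrib, sum_indicator_one,
        finrank_inf_isotropicLine hV hB hm hl, CharTwo.add_self_eq_zero]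
    · simp [h, CharTwo.add_self_eq_zero]
    · intro c v hc
      simp only [h, Set.indicator_apply, SetLike.mem_coe, Submodule.smul_mem_iff _ hc,
        Pi.one_apply]
  · intro a b _ _ ha hb
    rw [dotProduct_add, ha, hb, add_zero]
  · intro r a _ ha
    rw [dotProduct_smul, ha, smul_zero]

end DualGrid

/-! ### The quotient of two quadratic forms -/

section Ratio

variable {F V : Type*} [Field F] [AddCommGroup V] [Module F V] {B : LinearMap.BilinForm F V}

/-- In the coordinates of a symplectic frame `x, y, z, w`, the quotient `R / Q` of the quadratic
forms `R(v) = B(v, x) B(v, y)` and `Q(v) = B(v, x) B(v, y) + B(v, z) B(v, w)`, the second of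
which has polar form `B`. It is zero where `Q` vanishes. -/
def ratio (B : LinearMap.BilinForm F V) (x y z w v : V) : F :=
  (B v x * B v y) / (B v x * B v y + B v z * B v w)

variable {x y z w : V}

@[simp] lemma ratio_zero : ratio B x y z w 0 = 0 := by simp [ratio]

lemma ratio_smul {c : F} (hc : c ≠ 0) (v : V) : ratio B x y z w (c • v) = ratio B x y z w v := by
  simp only [ratio, map_smul, LinearMap.smul_apply, smul_eq_mul]
  rw [show c * B v x * (c * B v y) = c ^ 2 * (B v x * B v y) by ring,
    show c * B v z * (c * B v w) = c ^ 2 * (B v z * B v w) by ring, ← mul_add,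
    mul_div_mul_left _ _ (pow_ne_zero 2 hc)]

lemma IsSymplecticFrame.ratio_apply (h : IsSymplecticFrame B x y z w) (s t : V) (a b : F) :
    ratio B x y z w (a • s + b • t) =
      ((B s x * B s y) * a ^ 2 + (B s x * B t y + B s y * B t x) * (a * b) +
        (B t x * B t y) * b ^ 2) /
      ((B s x * B s y + B s z * B s w) * a ^ 2 + B s t * (a * b) +
        (B t x * B t y + B t z * B t w) * b ^ 2) := by
  rw [h.bilin_apply s t, ratio]
  simp only [map_add, map_smul, LinearMap.add_apply, LinearMap.smul_apply, smul_eq_mul]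
  congr 1 <;> ring

variable [Fintype F] [CharP F 2]

/-- For a hyperbolic pair `s, t` the sum of `R / Q` over the plane it spans is the value at
`(s, t)` of the polar form of `R`. -/
lemma IsSymplecticFrame.sum_ratio (h : IsSymplecticFrame B x y z w) (hq : 2 < Fintype.card F)
    {s t : V} (hst : B s t = 1) :
    ∑ a : F, ∑ b : F, ratio B x y z w (a • s + b • t) = B s x * B t y + B s y * B t x := by
  simp only [h.ratio_apply]
  rw [sum_binary_form_div hq _ _ _ _ _ (by rw [hst]; exact one_ne_zero), hst, div_one]

/-- On an isotropic line the form `Q` is additive, so that `Q / R` sums to zero over the line. -/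
lemma IsSymplecticFrame.sum_inv_ratio (h : IsSymplecticFrame B x y z w)
    (hq : 2 < Fintype.card F) {s t : V} (hst : B s t = 0) :
    ∑ a : F, ∑ b : F, (ratio B x y z w (a • s + b • t))⁻¹ = 0 := by
  simp only [h.ratio_apply, hst, zero_mul, add_zero, inv_div]
  exact sum_diagonal_form_div hq _ _ _ _ _

/-- The sums of `R / Q` over a non-isotropic line and over its orthogonal differ by one. -/
lemma IsSymplecticFrame.sum_ratio_add_sum_ratio (h : IsSymplecticFrame B x y z w)
    (hAlt : B.IsAlt) (hq : 2 < Fintype.card F) {x' y' z' w' : V}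
    (h' : IsSymplecticFrame B x' y' z' w') :
    ∑ a : F, ∑ b : F, ratio B x y z w (a • x' + b • y') +
      ∑ a : F, ∑ b : F, ratio B x y z w (a • z' + b • w') = 1 := by
  rw [h.sum_ratio hq h'.xy, h.sum_ratio hq h'.zw, ← h.xy, h'.bilin_apply x y]
  simp only [bilin_comm hAlt x, bilin_comm hAlt y]
  ring

/-- For `t = R / Q` the sums of `t + t²` over a non-isotropic line and its orthogonal cancel,
since squaring is additive and the two sums of `t` add up to one. -/
lemma IsSymplecticFrame.sum_ratio_add_sq (h : IsSymplecticFrame B x y z w)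
    (hAlt : B.IsAlt) (hq : 2 < Fintype.card F) {x' y' z' w' : V}
    (h' : IsSymplecticFrame B x' y' z' w') :
    ∑ a : F, ∑ b : F, (ratio B x y z w (a • x' + b • y') +
        ratio B x y z w (a • x' + b • y') ^ 2) +
      ∑ a : F, ∑ b : F, (ratio B x y z w (a • z' + b • w') +
        ratio B x y z w (a • z' + b • w') ^ 2) = 0 := by
  have key := h.sum_ratio_add_sum_ratio hAlt hq h'
  simp only [Finset.sum_add_distrib, ← CharTwo.sum_sq]
  rw [add_add_add_comm, ← CharTwo.add_sq, key, one_pow, CharTwo.add_self_eq_zero]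

lemma inv_mul_add_sq {K : Type*} [Field K] [CharP K 2] {P : K} (hP : P ≠ 0) (D : K) :
    (P / (P + D))⁻¹ * (P / (P + D) + (P / (P + D)) ^ 2) = D / (P + D) := by
  have h2 : (2 : K) = 0 := CharTwo.two_eq_zero
  by_cases hQ : P + D = 0
  · simp [hQ]
  · field_simp
    linear_combination P * h2

variable [Fintype V]

/-- The coordinates of a symplectic frame turn sums over `V` into sums over `F⁴`. -/
lemma IsSymplecticFrame.sum_eq (h : IsSymplecticFrame B x y z w) (hAlt : B.IsAlt)
    (g : V → F) :
    ∑ v, g v = ∑ a : F, ∑ b : F, ∑ c : F, ∑ d : F, g ((a • x + b • y) + (c • z + d • w)) := by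
  have hyx : B y x = 1 := by rw [bilin_comm hAlt, h.xy]
  have hwz : B w z = 1 := by rw [bilin_comm hAlt, h.zw]
  have hbij : Function.Bijective fun c : F × F × F × F =>
      (c.1 • x + c.2.1 • y) + (c.2.2.1 • z + c.2.2.2 • w) := by
    refine ⟨Function.LeftInverse.injective (g := fun v => (B v y, B v x, B v w, B v z)) ?_,
      fun v => ⟨(B v y, B v x, B v w, B v z), (h.expand v).symm⟩⟩
    rintro ⟨a, b, c, d⟩
    simp [hAlt.self_eq_zero, h.xy, h.zw, h.xz, h.xw, h.yz, h.yw, hyx, hwz, bilin_comm hAlt z x,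
      bilin_comm hAlt z y, bilin_comm hAlt w x, bilin_comm hAlt w y]
  rw [← Fintype.sum_bijective _ hbij _ g fun _ => rfl]
  simp only [Fintype.sum_prod_type]

lemma IsSymplecticFrame.sum_inv_ratio_mul (h : IsSymplecticFrame B x y z w) (hAlt : B.IsAlt)
    (hq : 2 < Fintype.card F) :
    ∑ v, (ratio B x y z w v)⁻¹ * (ratio B x y z w v + ratio B x y z w v ^ 2) = 1 := by
  have hyx : B y x = 1 := by rw [bilin_comm hAlt, h.xy]
  have hwz : B w z = 1 := by rw [bilin_comm hAlt, h.zw]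
  have key : ∀ a b c d : F, ratio B x y z w ((a • x + b • y) + (c • z + d • w)) =
      (a * b) / (a * b + c * d) := by
    intro a b c d
    simp [ratio, hAlt.self_eq_zero, h.xy, h.zw, h.xz, h.xw, h.yz, h.yw, hyx, hwz,
      bilin_comm hAlt z x, bilin_comm hAlt z y, bilin_comm hAlt w x, bilin_comm hAlt w y,
      mul_comm]
  rw [h.sum_eq hAlt]
  simp only [key]
  -- Terms with a vanishing first or second coordinate are zero; fixing nonzero values of both
  -- leaves a sum equal to one, independently of these values.
  rw [sum_eq_of_const_off_zero _ 1]
  · simp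
  intro a ha
  rw [sum_eq_of_const_off_zero _ 1]
  · simp
  intro b hb
  simp only [inv_mul_add_sq (mul_ne_zero ha hb)]
  exact sum_div_const_add hq _

end Ratio

/-! ### Descent to the prime field -/

section Descent

variable {ι F : Type*} [Fintype ι] [Field F] [Finite F] [Algebra (ZMod 2) F]

/-- If all coordinates over `𝔽₂` of an `F`-valued word `w` lie in a binary code that is
orthogonal to the `F`-valued word `f`, then `w` is orthogonal to `f`. -/
lemma sum_mul_eq_zero_of_coord_mem (D : Submodule (ZMod 2) (ι → ZMod 2)) (w f : ι → F)
    (hw : ∀ φ : F →ₗ[ZMod 2] ZMod 2, (fun i => φ (w i)) ∈ D)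
    (hf : ∀ u ∈ D, ∑ i, u i • f i = 0) : ∑ i, w i * f i = 0 := by
  have : Module.Finite (ZMod 2) F := Module.Finite.of_finite
  let b := Module.finBasis (ZMod 2) F
  have h1 : ∀ i, w i * f i = ∑ j, b j * (b.coord j (w i) • f i) := by
    intro i
    conv_lhs => rw [← b.sum_repr (w i)]
    rw [Finset.sum_mul]
    refine Finset.sum_congr rfl fun j _ => ?_
    rw [smul_mul_assoc, mul_smul_comm]
    rfl
  simp only [h1]
  rw [Finset.sum_comm]
  refine Finset.sum_eq_zero fun j _ => ?_
  rw [← Finset.mul_sum, hf _ (hw (b.coord j)), mul_zero]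

end Descent

/-! ### The inclusion is strict -/

section Proper

variable {F V : Type*} [Field F] [AddCommGroup V] [Module F V] {B : LinearMap.BilinForm F V}
  [Fintype F] [CharP F 2] [Algebra (ZMod 2) F] [Fintype V] [Fintype (ℙ F V)] {x y z w : V}

/-- The words over `𝔽₂` obtained from `Q / R` by applying a linear functional lie in the dual
code of the isotropic lines. -/
lemma IsSymplecticFrame.coord_inv_ratio_mem (h : IsSymplecticFrame B x y z w)
    (hq : 2 < Fintype.card F) (φ : F →ₗ[ZMod 2] ZMod 2) :
    (fun p : ℙ F V => φ (ratio B x y z w p.rep)⁻¹) ∈ dualCode (lineCode B) := by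
  intro c hc
  refine Submodule.span_induction ?_ (dotProduct_zero _) ?_ ?_ hc
  · rintro _ ⟨l, hl, rfl⟩
    obtain ⟨s, t, hst, rfl⟩ := exists_eq_span_pair hl.1
    have h0 : B s t = 0 :=
      hl.2 s (Submodule.subset_span (by simp)) t (Submodule.subset_span (by simp))
    have key := h.sum_inv_ratio hq h0
    rw [← sum_indicator_span_pair hst (fun v => (ratio B x y z w v)⁻¹),
      ← sum_indicator_pointSet _ _ (by simp) (fun c v hc => by rw [ratio_smul hc])] at key
    rw [dotProduct_comm, ← map_zero φ, ← key, map_sum]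
    refine Finset.sum_congr rfl fun p _ => ?_
    rw [← charWord_smul, map_smul, smul_eq_mul]
  · intro a b _ _ ha hb
    rw [dotProduct_add, ha, hb, add_zero]
  · intro r a _ ha
    rw [dotProduct_smul, ha, smul_zero]

/-- The `F`-valued word `t + t²`, where `t = R / Q`, is orthogonal to all dual grids. -/
lemma IsSymplecticFrame.sum_smul_eq_zero (h : IsSymplecticFrame B x y z w)
    (hV : Module.finrank F V = 4) (hAlt : B.IsAlt) (hB : B.Nondegenerate)
    (hq : 2 < Fintype.card F) {u : ℙ F V → ZMod 2} (hu : u ∈ dualGridCode B) :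
    ∑ p, u p • (ratio B x y z w p.rep + ratio B x y z w p.rep ^ 2) = 0 := by
  refine Submodule.span_induction ?_ (by simp) ?_ ?_ hu
  · rintro _ ⟨_, ⟨m, hm, hni, rfl⟩, rfl⟩
    have hd := disjoint_pointSet (disjoint_orthogonal_of_not_isotropic hAlt hm hni)
    obtain ⟨x', y', z', w', h', hm1, hm2⟩ := exists_symplecticFrame hV hAlt hB hm hni
    have key := h.sum_ratio_add_sq hAlt hq h'
    let g : V → F := fun v => ratio B x y z w v + ratio B x y z w v ^ 2
    have hg : ∀ (c : F) v, c ≠ 0 → g (c • v) = g v := fun c v hc => by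
      simp only [g, ratio_smul hc]
    have hg0 : g 0 = 0 := by simp [g]
    rw [← sum_indicator_span_pair (linearIndependent_of_hyperbolic_pair hAlt h'.xy) g,
      ← sum_indicator_span_pair (linearIndependent_of_hyperbolic_pair hAlt h'.zw) g, ← hm1, ← hm2,
      ← sum_indicator_pointSet _ _ hg0 hg, ← sum_indicator_pointSet _ _ hg0 hg,
      ← Finset.sum_add_distrib] at key
    rw [← key]
    refine Finset.sum_congr rfl fun p _ => ?_
    exact (charWord_smul _ (fun p : ℙ F V => g p.rep) p).trans
      (congrFun (Set.indicator_union_of_disjoint hd _) p)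
  · intro a b _ _ ha hb
    simp only [Pi.add_apply, add_smul, Finset.sum_add_distrib, ha, hb, add_zero]
  · intro r a _ ha
    simp only [Pi.smul_apply, smul_assoc, ← Finset.smul_sum, ha, smul_zero]

lemma dualGridCode_ne (hV : Module.finrank F V = 4) (hAlt : B.IsAlt) (hB : B.Nondegenerate)
    (hq : 2 < Fintype.card F) (h : IsSymplecticFrame B x y z w) :
    dualGridCode B ≠ dualCode (lineCode B) := by
  intro heq
  have h0 := sum_mul_eq_zero_of_coord_mem (dualGridCode B)
    (fun p : ℙ F V => (ratio B x y z w p.rep)⁻¹)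
    (fun p => ratio B x y z w p.rep + ratio B x y z w p.rep ^ 2)
    (fun φ => by rw [heq]; exact h.coord_inv_ratio_mem hq φ)
    (fun u hu => h.sum_smul_eq_zero hV hAlt hB hq hu)
  have h1 := sum_rep_eq_sum (F := F)
    (fun v => (ratio B x y z w v)⁻¹ * (ratio B x y z w v + ratio B x y z w v ^ 2)) (by simp)
    (fun c v hc => by simp only [ratio_smul hc])
  rw [h0, h.sum_inv_ratio_mul hAlt hq] at h1
  exact zero_ne_one h1

end Proper

end SymplecticQuadrangle

theorem corollary3 {F V : Type*} [Field F] [Fintype F] [AddCommGroup V] [Module F V]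
    [Fintype (ℙ F V)] (n : ℕ) (hn : 2 ≤ n) (hF : Fintype.card F = 2 ^ n)
    (hV : Module.finrank F V = 4) (B : LinearMap.BilinForm F V) (hAlt : B.IsAlt)
    (hB : B.Nondegenerate) :
    SymplecticQuadrangle.dualGridCode B <
      SymplecticQuadrangle.dualCode (SymplecticQuadrangle.lineCode B) := by
  have : Module.Finite F V := Module.finite_of_finrank_pos (by omega)
  have : Finite V := Module.finite_of_finite F
  have := Fintype.ofFinite V
  have : CharP F 2 := charP_of_card_eq_prime_pow hF
  let _ := ZMod.algebra F 2
  have hq : 2 < Fintype.card F := by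
    rw [hF]
    exact lt_of_lt_of_le (by norm_num) (Nat.pow_le_pow_right (by norm_num : 0 < 2) hn)
  obtain ⟨x, y, z, w, h⟩ := 
    SymplecticQuadrangle.exists_symplecticFrame_of_nondegenerate hV hAlt hB
  exact lt_of_le_of_ne (SymplecticQuadrangle.dualGridCode_le hV hAlt hB)
    (SymplecticQuadrangle.dualGridCode_ne hV hAlt hB hq h)
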